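/- Let $G$ be a finite group and let $\tau\colon G\to G$ be an involutory anti-automorphism, that is, $\tau(g_1g_2)=\tau(g_2)\tau(g_1)$ and $\tau(\tau(g))=g$ for all $g,g_1,g_2\in G$. For $g\in G$ let $\zeta_\tau(g)=|\{h\in G:\tau(h^{-1})h=g\}|$, and let $v(g)=|\{h\in G: hg=gh\}|$ be the cardinality of the centralizer of $g$ in $G$. Then the following conditions are equivalent: (a) there exists an integer $n\geq 3$ such that $\sum_{g\in G}\zeta_\tau(g)^{n+1}=\sum_{g\in G}v(g)^n$; (b) for all integers $n\geq 1$ we have $\sum_{g\in G}\zeta_\tau(g)^{n+1}=\sum_{g\in G}v(g)^n$; (c) the group $G$ is abelian and $\tau$ is the identity map of $G$. -/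

import Mathlib

/-- An involutory anti-automorphism of a group (bijectivity follows from `invol`). -/
structure IsInvolutoryAntiAut {G : Type*} [Group G] (τ : G → G) : Prop where
  map_mul : ∀ a b : G, τ (a * b) = τ b * τ a
  invol : ∀ a : G, τ (τ a) = a

/-- The number of `h ∈ G` such that `τ(h⁻¹) h = g`. -/
noncomputable def zetaTau {G : Type*} [Group G] (τ : G → G) (g : G) : ℕ :=
  Nat.card {h : G // τ h⁻¹ * h = g}

/-- The cardinality of the centralizer of `g` in `G`. -/
noncomputable def centralizerCard {G : Type*} [Group G] (g : G) : ℕ :=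
  Nat.card (Subgroup.centralizer ({g} : Set G))

/-! Both sums run over `n`-tuples `t`: the left one counts the `k` conjugating each `t i` to `τ (t
i)`, the right one the `k` centralizing `t`. The former set is empty or a coset of the latter, so
equality of the sums forces `τ` to agree with some conjugation on every `n`-tuple. Conjugation
preserves products and `τ` reverses them, so a triple consisting of two elements and their product
yields commutativity; conjugation is then trivial, and so is `τ`. -/

/-- Double counting: the `n`-th powers of the fibre cardinalities of a relation count the
`n`-tuples, weighted by the number of their common relatives. -/
theorem sum_card_rel_pow {α β : Type*} [Fintype α] [Fintype β] (R : α → β → Prop) (n : ℕ) :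
    ∑ a : α, Nat.card {b : β // R a b} ^ n =
      ∑ t : Fin n → β, Nat.card {a : α // ∀ i, R a (t i)} := by
  classical
  have h (a : α) : Nat.card {b : β // R a b} ^ n =
      Nat.card {t : Fin n → β // ∀ i, R a (t i)} := by
    rw [Nat.card_congr (Equiv.subtypePiEquivPi (p := fun (_ : Fin n) b => R a b)), Nat.card_pi]
    simp
  rw [Finset.sum_congr rfl fun a _ => h a]
  simp only [Nat.card_eq_fintype_card, Fintype.card_subtype, Finset.card_filter]
  exact Finset.sum_comm

/-- Summing a function over the values of `f` with multiplicity. -/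
theorem sum_card_fiber_mul {α β : Type*} [Fintype α] [Fintype β] (f : α → β) (w : β → ℕ) :
    ∑ b : β, Nat.card {a : α // f a = b} * w b = ∑ a : α, w (f a) := by
  classical
  rw [← Finset.sum_fiberwise Finset.univ f]
  refine Finset.sum_congr rfl fun b _ => ?_
  rw [Finset.sum_congr rfl (g := fun _ => w b) (by simp +contextual), Finset.sum_const,
    Nat.card_eq_fintype_card, Fintype.card_subtype, smul_eq_mul]

section

variable {G : Type*} [Group G] {τ : G → G}

/-- Substituting `x * h` for the variable in the fibre through `h` makes the defining equation
linear in `τ h⁻¹`. -/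
theorem zetaTau_self (hτ : IsInvolutoryAntiAut τ) (h : G) :
    zetaTau τ (τ h⁻¹ * h) = Nat.card {x : G // τ h⁻¹ * x = τ x * τ h⁻¹} := by
  have h1 : τ 1 = 1 := by simpa using hτ.map_mul 1 1
  refine (Nat.card_congr ((Equiv.mulRight h).subtypeEquiv fun x => ?_)).symm
  have hx : τ x * τ x⁻¹ = 1 := by rw [← hτ.map_mul, inv_mul_cancel, h1]
  rw [Equiv.coe_mulRight, mul_inv_rev, hτ.map_mul, ← mul_assoc, mul_left_inj,
    eq_inv_of_mul_eq_one_right hx, mul_assoc, inv_mul_eq_iff_eq_mul]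

theorem sum_zetaTau_pow [Fintype G] (hτ : IsInvolutoryAntiAut τ) (n : ℕ) :
    ∑ g : G, zetaTau τ g ^ (n + 1) =
      ∑ t : Fin n → G, Nat.card {k : G // ∀ i, k * t i = τ (t i) * k} := by
  have hinv : Function.Involutive τ := hτ.invol
  calc ∑ g : G, zetaTau τ g ^ (n + 1)
      = ∑ g : G, Nat.card {h : G // τ h⁻¹ * h = g} * zetaTau τ g ^ n := by
        simp only [pow_succ', zetaTau]
    _ = ∑ h : G, Nat.card {x : G // τ h⁻¹ * x = τ x * τ h⁻¹} ^ n := by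
        rw [sum_card_fiber_mul (fun h => τ h⁻¹ * h) (fun g => zetaTau τ g ^ n)]
        simp only [zetaTau_self hτ]
    _ = ∑ k : G, Nat.card {x : G // k * x = τ x * k} ^ n :=
        Equiv.sum_comp ((Equiv.inv G).trans hinv.toPerm)
          (fun k => Nat.card {x : G // k * x = τ x * k} ^ n)
    _ = _ := sum_card_rel_pow (fun k x => k * x = τ x * k) n

theorem centralizerCard_eq (g : G) : centralizerCard g = Nat.card {x : G // g * x = x * g} :=
  Nat.card_congr (Equiv.subtypeEquivRight fun _ => Subgroup.mem_centralizer_singleton_iff.trans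
    eq_comm)

theorem sum_centralizerCard_pow [Fintype G] (n : ℕ) :
    ∑ g : G, centralizerCard g ^ n =
      ∑ t : Fin n → G, Nat.card {k : G // ∀ i, k * t i = t i * k} := by
  simp only [centralizerCard_eq]
  exact sum_card_rel_pow (fun k x : G => k * x = x * k) n

/-- The simultaneous conjugators of `t` into `s` form an empty set or a coset of the
centralizer of `t`. -/
theorem card_conjugators_le [Finite G] {ι : Type*} (t s : ι → G) :
    Nat.card {k : G // ∀ i, k * t i = s i * k} ≤ Nat.card {k : G // ∀ i, k * t i = t i * k} := by
  rcases isEmpty_or_nonempty {k : G // ∀ i, k * t i = s i * k} with _ | ⟨⟨c, hc⟩⟩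
  · simp
  · refine Nat.card_le_card_of_injective
      (fun k => ⟨c⁻¹ * k.1, fun i => ?_⟩) fun k l hkl => ?_
    · rw [mul_assoc, k.2 i, inv_mul_eq_iff_eq_mul, ← mul_assoc, ← mul_assoc, hc i]
      group
    · simpa [Subtype.ext_iff] using hkl

/-- Equality of the two power sums means that `τ` acts on every `n`-tuple as some
conjugation. -/
theorem exists_conjugator [Fintype G] (hτ : IsInvolutoryAntiAut τ) {n : ℕ}
    (h : ∑ g : G, zetaTau τ g ^ (n + 1) = ∑ g : G, centralizerCard g ^ n) (t : Fin n → G) :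
    ∃ k : G, ∀ i, k * t i = τ (t i) * k := by
  rw [sum_zetaTau_pow hτ, sum_centralizerCard_pow] at h
  have ht := (Finset.sum_eq_sum_iff_of_le
    fun t _ => card_conjugators_le t fun i => τ (t i)).mp h t (Finset.mem_univ t)
  have : Nonempty {k : G // ∀ i, k * t i = t i * k} := ⟨⟨1, by simp⟩⟩
  have hpos : 0 < Nat.card {k : G // ∀ i, k * t i = τ (t i) * k} := ht ▸ Nat.card_pos
  obtain ⟨⟨k, hk⟩⟩ := (Nat.card_pos_iff.mp hpos).1
  exact ⟨k, hk⟩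

theorem mul_comm_of_sum_eq [Fintype G] (hτ : IsInvolutoryAntiAut τ) {n : ℕ} (hn : 3 ≤ n)
    (h : ∑ g : G, zetaTau τ g ^ (n + 1) = ∑ g : G, centralizerCard g ^ n) (a b : G) :
    a * b = b * a := by
  obtain ⟨k, hk⟩ := exists_conjugator hτ h
    -- The third entry is `τ (b * a)`: `τ` sends it to `b * a`, while conjugation by `k` sends it to
    -- `a * b`. These three slots are where `3 ≤ n` is needed.
    fun i => if i.1 = 0 then τ a else if i.1 = 1 then τ b else τ a * τ b
  have ha : k * τ a = a * k := by simpa [hτ.invol] using hk ⟨0, by omega⟩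
  have hb : k * τ b = b * k := by simpa [hτ.invol] using hk ⟨1, by omega⟩
  have hab : k * (τ a * τ b) = b * a * k := by
    simpa [hτ.invol, hτ.map_mul] using hk ⟨2, by omega⟩
  apply mul_right_cancel (b := k)
  rw [← hab, ← mul_assoc, ha, mul_assoc, ← hb, mul_assoc]

theorem eq_id_of_sum_eq [Fintype G] (hτ : IsInvolutoryAntiAut τ) {n : ℕ} (hn : 3 ≤ n)
    (h : ∑ g : G, zetaTau τ g ^ (n + 1) = ∑ g : G, centralizerCard g ^ n) : τ = id := by
  funext a
  obtain ⟨k, hk⟩ := exists_conjugator hτ h fun _ => a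
  have hk := hk ⟨0, by omega⟩
  rw [mul_comm_of_sum_eq hτ hn h k a] at hk
  exact (mul_right_cancel hk).symm

end

theorem theorem6p10 {G : Type*} [Group G] [Fintype G] (τ : G → G)
    (hτ : IsInvolutoryAntiAut τ) :
    List.TFAE [
      ∃ n : ℕ, 3 ≤ n ∧ ∑ g : G, zetaTau τ g ^ (n + 1) = ∑ g : G, centralizerCard g ^ n,
      ∀ n : ℕ, 1 ≤ n → ∑ g : G, zetaTau τ g ^ (n + 1) = ∑ g : G, centralizerCard g ^ n,
      (∀ a b : G, a * b = b * a) ∧ τ = id] := by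
  tfae_have 1 → 3 := fun ⟨_, hn, h⟩ => ⟨mul_comm_of_sum_eq hτ hn h, eq_id_of_sum_eq hτ hn h⟩
  tfae_have 3 → 2 := by
    rintro ⟨_, rfl⟩ n _
    rw [sum_zetaTau_pow hτ, sum_centralizerCard_pow]
    rfl
  tfae_have 2 → 1 := fun h => ⟨3, le_rfl, h 3 (by norm_num)⟩
  tfae_finish
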